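/- A realtime alternating one-counter automaton (A1CA) over an input alphabet $\Sigma$ consists of a finite set $S$ of states, each of which is either existential or universal, an initial state $s_1\in S$, an accepting state $s_a\in S$, and a transition function $\delta: S\times(\Sigma\cup\{\#\})\times\{0,\pm\}\to\mathcal P(S\times\{-1,0,1\})$, where $\#\notin\Sigma$ is an end-marker. On input $w\in\Sigma^*$ the automaton reads $\#w\#$ from left to right and spends exactly two steps on each symbol, starting in state $s_1$ with its integer counter equal to $0$. In a step in state $s$ on symbol $\sigma$, with $\theta=0$ if the counter is zero and $\theta=\pm$ if it is nonzero, it branches to all $(s',d)\in\delta(s,\sigma,\theta)$, where $s'$ is the next state and $d$ is added to the counter. In the resulting computation tree, a leaf is true if it is reached after the last step and its state is $s_a$, and false otherwise (in particular, a node with no possible move before the last step is a false leaf). An inner node is true if at least one of its children is true (existential state), respectively if all of its children are true (universal state). The input is accepted if and only if the root is true. Theorem. The emptiness problem for A1CAs over a unary alphabet $\Sigma=\{u\}$ is undecidable: there is no algorithm that, given a finite description of such an automaton (its states, its universal states, its initial and accepting states, and the list of its transitions), decides whether the automaton accepts no word $u^n$, $n\ge 0$. -/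

import Mathlib

/-- A realtime alternating one-counter automaton with input alphabet `σ` and finite state set `S`.
A tape symbol is an element of `Option σ`: `some a` is an input letter, `none` is the end-marker.
`δ s x z` is the set of possible moves (next state, counter update in `{-1, 0, 1}`) in state `s` on
tape symbol `x`, where `z` is `true` if the counter value is zero and `false` if it is nonzero.
States that are not universal are existential. -/
structure A1CA (σ S : Type*) [Finite S] where
  isUniversal : S → Prop
  δ : S → Option σ → Bool → Set (S × SignType)
  initial : S
  accepting : S

namespace A1CA

variable {σ S : Type*} [Finite S]

/-- The tape symbols scanned in the successive steps on input `w`: the tape is `w` between two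
end-markers, and exactly two steps are spent on each of its symbols. -/
def schedule (w : List σ) : List (Option σ) :=
  (none :: (w.map some ++ [none])).flatMap fun x => [x, x]

/-- The truth value of the node (state `s`, counter value `c`) of the computation tree when the
symbols to be scanned in the remaining steps are those of the given list. When no step remains, the
node is an accepting leaf iff its state is the accepting one. A node without a possible move while
steps remain is a leaf that does not accept, whether its state is existential or universal. -/
def value (A : A1CA σ S) : List (Option σ) → S → ℤ → Prop
  | [], s, _ => s = A.accepting
  | x :: xs, s, c =>
    (A.isUniversal s ∧ (A.δ s x (decide (c = 0))).Nonempty ∧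
      ∀ p ∈ A.δ s x (decide (c = 0)), A.value xs p.1 (c + (p.2 : ℤ))) ∨
    (¬ A.isUniversal s ∧
      ∃ p ∈ A.δ s x (decide (c = 0)), A.value xs p.1 (c + (p.2 : ℤ)))

/-- The language of the automaton; the counter starts at `0`. -/
def language (A : A1CA σ S) : Language σ :=
  {w | A.value (schedule w) A.initial 0}

end A1CA

instance : Primcodable SignType :=
  Primcodable.ofEquiv (Fin 3) SignType.fin3Equiv.toEquiv

/-- A finite description of a unary A1CA, the form in which an automaton is given to an algorithm.
States are named by natural numbers. A transition `((s, x, z), (t, k))` says `(t, k) ∈ δ(s, x, z)`.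
The universal states are listed; all other states are existential. -/
structure UnaryA1CACode where
  states : List ℕ
  universal : List ℕ
  transitions : List ((ℕ × Option Unit × Bool) × (ℕ × SignType))
  initial : ℕ
  accepting : ℕ

namespace UnaryA1CACode

/-- A description as the tuple of its components. -/
def equivTuple : UnaryA1CACode ≃
    List ℕ × List ℕ × List ((ℕ × Option Unit × Bool) × (ℕ × SignType)) × ℕ × ℕ where
  toFun d := (d.states, d.universal, d.transitions, d.initial, d.accepting)
  invFun t := ⟨t.1, t.2.1, t.2.2.1, t.2.2.2.1, t.2.2.2.2⟩
  left_inv _ := rfl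
  right_inv _ := rfl

instance : Primcodable UnaryA1CACode := Primcodable.ofEquiv _ equivTuple

/-- The finite state set of the described automaton: the names in the list `states` together with
all names that occur elsewhere in the description. Thus every description is meaningful. -/
def stateSet (d : UnaryA1CACode) : Finset ℕ :=
  (d.initial :: d.accepting :: (d.states ++ d.universal ++
    d.transitions.flatMap fun r => [r.1.1, r.2.1])).toFinset

/-- The automaton over the one-letter alphabet `Unit` with the given description. -/
def toA1CA (d : UnaryA1CACode) : A1CA Unit d.stateSet where
  isUniversal s := s.1 ∈ d.universal
  δ s x z := {p | ((s.1, x, z), (p.1.1, p.2)) ∈ d.transitions}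
  initial := ⟨d.initial, by simp [stateSet]⟩
  accepting := ⟨d.accepting, by simp [stateSet]⟩

end UnaryA1CACode

/-! A one-counter automaton can verify a space-time diagram of a one-dimensional cellular automaton
backwards in time. The counter holds a cell position, the control state a claim "this cell has state
`q`", and the number of letters left is the time. On each letter, the first step guesses a triple of
predecessor states that the rule maps to `q`; the second branches universally over the three
neighbours, moving the counter by -1, 0 or 1. At the last end-marker the zero test tells cell `0`
from the others, which suffices when the initial configuration has one state in cell `0` and another
everywhere else. As the rule is deterministic, only true claims survive, so `u^n` is accepted iff
cell `0` has the goal state at time `n` (`holds_iff_diagram`).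

It remains to encode halting. A fixed Turing machine has undecidable halting problem on inputs `a b
⋯ b` (`exists_turingMachine_undecidable`). A cellular automaton started from the single cell `inr n`
writes this input, simulates the machine, and upon halting sends out a signal that eventually
reaches cell `0` (`exists_diagram_loadRule_eq_iff`). The language is thus nonempty iff the machine
halts, and the description is computable from `n`. -/

open Turing

/-! ### A fixed Turing machine with undecidable halting problem on block inputs -/

/-- The number whose binary representation consists of `n + 1` ones. -/
def binaryOnes (n : ℕ) : ℕ := n.rec 1 fun _ r => 2 * r + 1

theorem binaryOnes_succ (n : ℕ) : binaryOnes (n + 1) = 2 * binaryOnes n + 1 := rfl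

theorem binaryOnes_strictMono : StrictMono binaryOnes :=
  strictMono_nat_of_lt_succ fun n => by rw [binaryOnes_succ]; omega

theorem primrec_binaryOnes : Primrec binaryOnes :=
  Primrec.nat_rec₁ 1 <| Primrec.to₂ <|
    Primrec.succ.comp (Primrec.nat_mul.comp (Primrec.const 2) Primrec.snd)

theorem trNat_binaryOnes (n : ℕ) :
    PartrecToTM2.trNat (binaryOnes n) = List.replicate (n + 1) PartrecToTM2.Γ'.bit1 := by
  have key : ∀ n, ∃ p : PosNum, ((binaryOnes n : ℕ) : Num) = Num.pos p ∧
      PartrecToTM2.trPosNum p = List.replicate (n + 1) PartrecToTM2.Γ'.bit1 := by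
    intro n
    induction n with
    | zero => exact ⟨PosNum.one, by simp [binaryOnes]; rfl, rfl⟩
    | succ n ih =>
      obtain ⟨p, hp, hl⟩ := ih
      refine ⟨p.bit1, ?_, by rw [PartrecToTM2.trPosNum, hl]; rfl⟩
      have h : ((2 * binaryOnes n + 1 : ℕ) : Num) = (Num.pos p).bit1 := by
        rw [← hp, ← Num.bit1_of_bit1]
        push_cast
        ring
      exact h
  obtain ⟨p, hp, hl⟩ := key n
  rw [PartrecToTM2.trNat, hp]
  exact hl

/-- The restriction of a Turing machine to a set of states that supports it. -/
def Turing.TM0.Machine.restrict {Γ Λ : Type*} [Inhabited Γ] [Inhabited Λ] (M : TM0.Machine Γ Λ)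
    {S : Set Λ} (hS : TM0.Supports M S) : letI : Inhabited S := ⟨⟨default, hS.1⟩⟩; TM0.Machine Γ S :=
  fun q a => (M q a).attach.map fun p => (⟨p.1.1, hS.2 p.2 q.2⟩, p.1.2)

/-- Forgetting that states lie in `S` maps each step of the restricted machine to a step of `M`, so
the two runs halt together. -/
theorem Turing.TM0.restrict_eval_dom {Γ Λ : Type*} [Inhabited Γ] [Inhabited Λ]
    (M : TM0.Machine Γ Λ) {S : Set Λ} (hS : TM0.Supports M S) (l : List Γ) :
    letI : Inhabited S := ⟨⟨default, hS.1⟩⟩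
    (TM0.eval (M.restrict hS) l).Dom ↔ (TM0.eval M l).Dom := by
  let : Inhabited S := ⟨⟨default, hS.1⟩⟩
  have hr : StateTransition.Respects (TM0.step (M.restrict hS)) (TM0.step M)
      fun (c : TM0.Cfg Γ S) (c' : TM0.Cfg Γ Λ) => (⟨c.q.1, c.Tape⟩ : TM0.Cfg Γ Λ) = c' := by
    refine StateTransition.fun_respects.2 ?_
    rintro ⟨q, T⟩
    have h : ∀ o (ho : M q T.head = o), StateTransition.FRespects (TM0.step M)
        (fun c : TM0.Cfg Γ S => (⟨c.q.1, c.Tape⟩ : TM0.Cfg Γ Λ)) ⟨q.1, T⟩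
        (TM0.step (M.restrict hS) ⟨q, T⟩) := by
      intro o ho
      cases o with
      | none =>
        have h1 : M.restrict hS q T.head = none := by
          simp [TM0.Machine.restrict, Option.attach_eq_none_iff, ho]
        simp only [TM0.step, h1, Option.map_none, StateTransition.FRespects, ho]
      | some p =>
        have h1 : M.restrict hS q T.head = some (⟨p.1, hS.2 ho q.2⟩, p.2) := by
          simp [TM0.Machine.restrict, Option.map_eq_some_iff, Option.attach_eq_some_iff, ho]
        simp only [TM0.step, h1, Option.map_some, StateTransition.FRespects]
        refine Relation.TransGen.single ?_
        simp only [TM0.step, ho, Option.map_some, Option.mem_def]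
    exact h _ rfl
  exact (StateTransition.tr_eval_dom hr rfl).symm

instance : Finite PartrecToTM2.K' :=
  Finite.of_injective (β := Fin 4) (fun k => k.casesOn 0 1 2 3) fun a b => by
    cases a <;> cases b <;> simp

instance {K : Type*} [Finite K] {Γ : K → Type*} [∀ k, Finite (Γ k)] : Finite (TM2to1.Γ' K Γ) :=
  inferInstanceAs (Finite (Bool × ∀ k, Option (Γ k)))

/-- A cell of the tape that represents the stacks of `PartrecToTM2.tr`, with only the main stack
occupied; `bottom` marks the bottom of the stacks. -/
def mainStackSymbol (bottom : Bool) (x : PartrecToTM2.Γ') :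
    TM2to1.Γ' PartrecToTM2.K' fun _ => PartrecToTM2.Γ' :=
  (bottom, Function.update (fun _ => none) PartrecToTM2.K'.main (some x))

/-- Numbers are stored in binary, so numbers with all digits one yield inputs with a single repeated
letter. The terminator `cons` lies at the bottom of the stack and becomes the first letter. -/
theorem trInit_trList_binaryOnes (n : ℕ) :
    TM2to1.trInit (Γ := fun _ => PartrecToTM2.Γ') PartrecToTM2.K'.main
      (PartrecToTM2.trList [binaryOnes n]) =
    mainStackSymbol true .cons :: List.replicate (n + 1) (mainStackSymbol false .bit1) := by
  have h : (PartrecToTM2.trList [binaryOnes n]).reverse =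
      PartrecToTM2.Γ'.cons :: List.replicate (n + 1) PartrecToTM2.Γ'.bit1 := by
    simp [trNat_binaryOnes]
  unfold TM2to1.trInit
  rw [h]
  exact congrArg (mainStackSymbol true PartrecToTM2.Γ'.cons :: ·) List.map_replicate

/-- The halting problem for a function on `ℕ` is reduced to that for a Turing machine with finitely
many states and symbols on inputs that consist of one letter and a block of another one. -/
theorem exists_turingMachine_of_partrec {f : ℕ →. ℕ} (hf : Nat.Partrec f) :
    ∃ (Γ Λ : Type) (_ : Inhabited Γ) (_ : Inhabited Λ) (_ : Finite Γ) (_ : Finite Λ)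
      (M : TM0.Machine Γ Λ) (a b : Γ), ∀ n,
      (TM0.eval M (a :: List.replicate (n + 1) b)).Dom ↔ (f (binaryOnes n)).Dom := by
  obtain ⟨c, hc⟩ := ToPartrec.Code.exists_code (Nat.Partrec'.part_iff₁.2 (Partrec.nat_iff.2 hf))
  -- The default label is the start state, so it must be the entry point of `c`.
  let : Inhabited PartrecToTM2.Λ' := ⟨PartrecToTM2.trNormal c PartrecToTM2.Cont'.halt⟩
  have s2 := PartrecToTM2.tr_supports c PartrecToTM2.Cont'.halt
  -- The label types are infinite, but a finite set closed under the transitions survives both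
  -- translations.
  have s0 := TM1to0.tr_supports _ (TM2to1.tr_supports PartrecToTM2.tr s2)
  let i0 : Inhabited (TM1to0.trStmts (TM2to1.tr PartrecToTM2.tr)
    (TM2to1.trSupp PartrecToTM2.tr (PartrecToTM2.codeSupp c PartrecToTM2.Cont'.halt)) :
      Set (TM1to0.Λ' (TM2to1.tr PartrecToTM2.tr))) := ⟨⟨default, s0.1⟩⟩
  refine ⟨_, _, inferInstance, i0, inferInstance, inferInstance,
    (TM1to0.tr (TM2to1.tr PartrecToTM2.tr)).restrict s0,
    mainStackSymbol true .cons, mainStackSymbol false .bit1, fun n => ?_⟩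
  refine (TM0.restrict_eval_dom _ s0 _).trans ?_
  rw [TM1to0.tr_eval, ← trInit_trList_binaryOnes]
  refine (TM2to1.tr_eval_dom PartrecToTM2.tr _ _).trans ?_
  have hi : TM2.init PartrecToTM2.K'.main (PartrecToTM2.trList [binaryOnes n]) =
      PartrecToTM2.init c [binaryOnes n] := by
    unfold TM2.init PartrecToTM2.init
    congr 1
    funext k
    cases k <;> simp [PartrecToTM2.K'.elim]
  have he := PartrecToTM2.tr_eval c [binaryOnes n]
  have h1 := hc ⟨[binaryOnes n], rfl⟩
  simp only at h1
  unfold TM2.eval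
  rw [hi, he, h1]
  rfl

/-- There is a Turing machine with undecidable halting problem on inputs that consist of one letter
and a block of another one. -/
theorem exists_turingMachine_undecidable :
    ∃ (Γ Λ : Type) (_ : Inhabited Γ) (_ : Inhabited Λ) (_ : Finite Γ) (_ : Finite Λ)
      (M : TM0.Machine Γ Λ) (a b : Γ),
      ¬ ComputablePred fun n : ℕ => (TM0.eval M (a :: List.replicate (n + 1) b)).Dom := by
  -- A computable left inverse of `binaryOnes`; it lets one fixed function run the `n`-th program on
  -- input `binaryOnes n`.
  let g : ℕ → ℕ := fun m => m.findGreatest fun k => binaryOnes k ≤ m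
  have hg : Computable g := (Primrec.nat_findGreatest (p := fun m k => binaryOnes k ≤ m) Primrec.id
    (Primrec.nat_le.comp (primrec_binaryOnes.comp Primrec.snd) Primrec.fst)).to_comp
  have hgn : ∀ n, g (binaryOnes n) = n := fun n => by
    simp only [g, Nat.findGreatest_eq_iff]
    exact ⟨binaryOnes_strictMono.le_apply, fun _ => le_rfl,
      fun k hk _ => (binaryOnes_strictMono hk).not_ge⟩
  let f : ℕ →. ℕ := fun m => (Denumerable.ofNat Nat.Partrec.Code (g m)).eval 0
  have hf : Partrec f := Nat.Partrec.Code.eval_part.comp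
    ((Computable.ofNat Nat.Partrec.Code).comp hg) (Computable.const 0)
  obtain ⟨Γ, Λ, i1, i2, i3, i4, M, a, b, hM⟩ := exists_turingMachine_of_partrec (Partrec.nat_iff.1 hf)
  refine ⟨Γ, Λ, i1, i2, i3, i4, M, a, b, fun h => ComputablePred.halting_problem 0 ?_⟩
  refine (ComputablePred.computable_iff.2 ?_)
  obtain ⟨p, hp, hpe⟩ := ComputablePred.computable_iff.1 h
  refine ⟨fun c => p (Encodable.encode c), hp.comp Computable.encode, funext fun c => ?_⟩
  have h2 := congrFun hpe (Encodable.encode c)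
  rw [← h2, hM]
  simp [f, hgn]

/-! ### Acceptance in terms of state names -/

namespace UnaryA1CACode

/-- The truth value of a node of the computation tree of the described automaton, with states given
by their names. -/
def Holds (d : UnaryA1CACode) : List (Option Unit) → ℕ → ℤ → Prop
  | [], s, _ => s = d.accepting
  | x :: xs, s, c =>
    (s ∈ d.universal ∧ (∃ p, ((s, x, decide (c = 0)), p) ∈ d.transitions) ∧
      ∀ p, ((s, x, decide (c = 0)), p) ∈ d.transitions → d.Holds xs p.1 (c + (p.2 : ℤ))) ∨
    (s ∉ d.universal ∧
      ∃ p, ((s, x, decide (c = 0)), p) ∈ d.transitions ∧ d.Holds xs p.1 (c + (p.2 : ℤ)))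

theorem mem_stateSet_of_transition {d : UnaryA1CACode} {r : ℕ × Option Unit × Bool}
    {p : ℕ × SignType} (h : (r, p) ∈ d.transitions) : p.1 ∈ d.stateSet := by
  simp only [stateSet, List.mem_toFinset, List.mem_cons, List.mem_append, List.mem_flatMap]
  exact Or.inr (Or.inr (Or.inr ⟨_, h, by simp⟩))

/-- Targets of transitions always belong to `stateSet`, so passing to the subtype of states loses no
moves. -/
theorem value_iff_holds (d : UnaryA1CACode) (xs : List (Option Unit)) :
    ∀ (s : d.stateSet) (c : ℤ), d.toA1CA.value xs s c ↔ d.Holds xs s c := by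
  induction xs with
  | nil => exact fun s c => Subtype.ext_iff
  | cons x xs ih =>
    intro s c
    simp only [A1CA.value, Holds, ih]
    refine or_congr (and_congr_right' (and_congr ?_ ?_)) (and_congr_right' ?_)
    · exact ⟨fun ⟨p, h⟩ => ⟨_, h⟩,
        fun ⟨p, h⟩ => ⟨(⟨p.1, mem_stateSet_of_transition h⟩, p.2), h⟩⟩
    · exact ⟨fun H p h => H (⟨p.1, mem_stateSet_of_transition h⟩, p.2) h, fun H p h => H _ h⟩
    · exact ⟨fun ⟨p, h⟩ => ⟨_, h⟩,
        fun ⟨p, h⟩ => ⟨(⟨p.1, mem_stateSet_of_transition h.1⟩, p.2), h⟩⟩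

end UnaryA1CACode

/-! ### Verifying cellular automata by alternating counter automata -/

/-- The control states of an automaton that evaluates a cellular automaton with cell states `Q`: a
claim about the state of a cell, a claim about the states of a cell and its neighbours, or one of
three auxiliary states. -/
abbrev CellularAutomaton.ControlState (Q : Type*) := Q ⊕ (Q × Q × Q) ⊕ Fin 3

namespace CellularAutomaton

/-- The configuration with the state `origin` in cell `0` and the state `blank` in all others. -/
def singleCell {Q : Type*} (origin blank : Q) (c : ℤ) : Q := if c = 0 then origin else blank

/-- The space-time diagram of the cellular automaton with local rule `f`, started in the
configuration `g`. -/
def diagram {Q : Type*} (f : Q → Q → Q → Q) (g : ℤ → Q) : ℕ → ℤ → Q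
  | 0, c => g c
  | t + 1, c => f (diagram f g t (c - 1)) (diagram f g t c) (diagram f g t (c + 1))

variable {Q : Type*} [Primcodable Q]

/-- The name of a control state. -/
def stateName (s : ControlState Q) : ℕ := Encodable.encode s

@[simp]
theorem stateName_inj {s t : ControlState Q} : stateName s = stateName t ↔ s = t :=
  Encodable.encode_inj

theorem primrec_stateName : Primrec (stateName (Q := Q)) := Primrec.encode

/-- The transitions with which a claim about the successor of the triple `(a, b, c)` is reduced to
claims about `a`, `b` and `c`. -/
def tripleTransitions (f : Q → Q → Q → Q) (a b c : Q) (z : Bool) :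
    List ((ℕ × Option Unit × Bool) × (ℕ × SignType)) :=
  [((stateName (.inl (f a b c)), some (), z), (stateName (.inr (.inl (a, b, c)) : ControlState Q), 0)),
    ((stateName (.inr (.inl (a, b, c)) : ControlState Q), some (), z),
      (stateName (.inl a : ControlState Q), -1)),
    ((stateName (.inr (.inl (a, b, c)) : ControlState Q), some (), z),
      (stateName (.inl b : ControlState Q), 0)),
    ((stateName (.inr (.inl (a, b, c)) : ControlState Q), some (), z),
      (stateName (.inl c : ControlState Q), 1))]

/-- The transitions on the end-markers: at the first one the automaton claims that cell `0` has the
state `goal`, at the last one it compares a claim with the initial configuration. -/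
def markerTransitions (origin blank goal : Q) :
    List ((ℕ × Option Unit × Bool) × (ℕ × SignType)) :=
  [((stateName (.inr (.inr 0) : ControlState Q), none, true),
      (stateName (.inr (.inr 1) : ControlState Q), 0)),
    ((stateName (.inr (.inr 1) : ControlState Q), none, true),
      (stateName (.inl goal : ControlState Q), 0)),
    ((stateName (.inl origin : ControlState Q), none, true),
      (stateName (.inr (.inr 2) : ControlState Q), 0)),
    ((stateName (.inl blank : ControlState Q), none, false),
      (stateName (.inr (.inr 2) : ControlState Q), 0)),
    ((stateName (.inr (.inr 2) : ControlState Q), none, true),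
      (stateName (.inr (.inr 2) : ControlState Q), 0)),
    ((stateName (.inr (.inr 2) : ControlState Q), none, false),
      (stateName (.inr (.inr 2) : ControlState Q), 0))]

/-- An alternating one-counter automaton that accepts the word of length `n` if and only if, in the
cellular automaton with rule `f` and cell states `cells`, cell `0` has the state `goal` at time `n`.
The counter value is the position of a cell. -/
def toCode (f : Q → Q → Q → Q) (cells : List Q) (origin blank goal : Q) : UnaryA1CACode where
  states := []
  universal := cells.flatMap fun a => cells.flatMap fun b => cells.map fun c =>
    stateName (.inr (.inl (a, b, c)) : ControlState Q)
  transitions := markerTransitions origin blank goal ++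
    cells.flatMap fun a => cells.flatMap fun b => cells.flatMap fun c =>
      tripleTransitions f a b c true ++ tripleTransitions f a b c false
  initial := stateName (.inr (.inr 0) : ControlState Q)
  accepting := stateName (.inr (.inr 2) : ControlState Q)

section

variable {f : Q → Q → Q → Q} {cells : List Q} {origin blank goal : Q}

theorem mem_universal (s : ControlState Q) :
    stateName s ∈ (toCode f cells origin blank goal).universal ↔
      ∃ a ∈ cells, ∃ b ∈ cells, ∃ c ∈ cells, s = .inr (.inl (a, b, c)) := by
  simp [toCode, eq_comm]

theorem mem_transitions_marker (s : ControlState Q) (z : Bool) (p : ℕ × SignType) :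
    ((stateName s, none, z), p) ∈ (toCode f cells origin blank goal).transitions ↔
      ((stateName s, none, z), p) ∈ markerTransitions origin blank goal := by
  simp [toCode, tripleTransitions]

theorem mem_transitions_letter (s : ControlState Q) (z : Bool) (p : ℕ × SignType) :
    ((stateName s, some (), z), p) ∈ (toCode f cells origin blank goal).transitions ↔
      ∃ a ∈ cells, ∃ b ∈ cells, ∃ c ∈ cells,
        (s = .inl (f a b c) ∧ p = (stateName (.inr (.inl (a, b, c)) : ControlState Q), 0)) ∨
        (s = .inr (.inl (a, b, c)) ∧ (p = (stateName (.inl a : ControlState Q), -1) ∨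
          p = (stateName (.inl b : ControlState Q), 0) ∨
          p = (stateName (.inl c : ControlState Q), 1))) := by
  cases z <;> simp [toCode, tripleTransitions, markerTransitions, and_or_left]

/-- A claim about a cell is checked on two copies of a letter by guessing the states of the cell and
its neighbours one step earlier. -/
theorem holds_letter (xs : List (Option Unit)) (q : Q) (c : ℤ) :
    (toCode f cells origin blank goal).Holds (some () :: some () :: xs)
        (stateName (.inl q : ControlState Q)) c ↔
      ∃ a ∈ cells, ∃ b ∈ cells, ∃ d ∈ cells, q = f a b d ∧
        (toCode f cells origin blank goal).Holds xs (stateName (.inl a : ControlState Q)) (c - 1) ∧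
        (toCode f cells origin blank goal).Holds xs (stateName (.inl b : ControlState Q)) c ∧
        (toCode f cells origin blank goal).Holds xs (stateName (.inl d : ControlState Q)) (c + 1) := by
  have h1 : ∀ a ∈ cells, ∀ b ∈ cells, ∀ d ∈ cells,
      ((toCode f cells origin blank goal).Holds (some () :: xs)
        (stateName (.inr (.inl (a, b, d)) : ControlState Q)) c ↔
        (toCode f cells origin blank goal).Holds xs (stateName (.inl a : ControlState Q)) (c - 1) ∧
        (toCode f cells origin blank goal).Holds xs (stateName (.inl b : ControlState Q)) c ∧
        (toCode f cells origin blank goal).Holds xs (stateName (.inl d : ControlState Q))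
          (c + 1)) := by
    intro a ha b hb d hd
    have hu : stateName (.inr (.inl (a, b, d)) : ControlState Q) ∈
        (toCode f cells origin blank goal).universal :=
      (mem_universal _).2 ⟨a, ha, b, hb, d, hd, rfl⟩
    have ht : ∀ p, ((stateName (.inr (.inl (a, b, d)) : ControlState Q), some (), decide (c = 0)), p)
        ∈ (toCode f cells origin blank goal).transitions ↔
          (p = (stateName (.inl a : ControlState Q), -1) ∨
          p = (stateName (.inl b : ControlState Q), 0) ∨
          p = (stateName (.inl d : ControlState Q), 1)) := by
      intro p
      rw [mem_transitions_letter]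
      constructor
      · rintro ⟨a', -, b', -, d', -, ⟨h, -⟩ | ⟨h, h'⟩⟩
        · cases h
        · cases h
          exact h'
      · exact fun h => ⟨a, ha, b, hb, d, hd, Or.inr ⟨rfl, h⟩⟩
    simp only [UnaryA1CACode.Holds, hu, ht, true_and, not_true_eq_false, false_and, or_false]
    simp [sub_eq_add_neg]
  have hu : stateName (.inl q : ControlState Q) ∉
      (toCode f cells origin blank goal).universal := by simp [mem_universal]
  rw [UnaryA1CACode.Holds]
  simp only [hu, mem_transitions_letter, false_and, false_or, not_false_eq_true, true_and]
  constructor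
  · rintro ⟨p, ⟨a, ha, b, hb, d, hd, ⟨h, rfl⟩ | ⟨h, h'⟩⟩, hp⟩
    · cases h
      exact ⟨a, ha, b, hb, d, hd, rfl, (h1 a ha b hb d hd).1 (by simpa using hp)⟩
    · cases h
  · rintro ⟨a, ha, b, hb, d, hd, rfl, h⟩
    refine ⟨_, ⟨a, ha, b, hb, d, hd, Or.inl ⟨rfl, rfl⟩⟩, ?_⟩
    simpa using (h1 a ha b hb d hd).2 h

/-- On the last end-marker a claim about a cell is compared with the initial configuration. -/
theorem holds_last_marker (q : Q) (c : ℤ) :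
    (toCode f cells origin blank goal).Holds [none, none]
      (stateName (.inl q : ControlState Q)) c ↔ singleCell origin blank c = q := by
  have hu : stateName (.inl q : ControlState Q) ∉
      (toCode f cells origin blank goal).universal := by simp [mem_universal]
  have hu2 : stateName (.inr (.inr 2) : ControlState Q) ∉
      (toCode f cells origin blank goal).universal := by simp [mem_universal]
  have ha : (toCode f cells origin blank goal).accepting =
    stateName (.inr (.inr 2) : ControlState Q) := rfl
  -- `origin` has a move only at counter zero, `blank` only at a nonzero counter, and any other
  -- claim is stuck. The accepting state then idles for the second step.
  by_cases hc : c = 0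
  · simp [UnaryA1CACode.Holds, mem_transitions_marker, markerTransitions, hu, hu2, hc, ha, singleCell]
    exact eq_comm
  · simp [UnaryA1CACode.Holds, mem_transitions_marker, markerTransitions, hu, hu2, hc, ha, singleCell]
    exact eq_comm

theorem holds_first_marker (xs : List (Option Unit)) :
    (toCode f cells origin blank goal).Holds (none :: none :: xs)
      (toCode f cells origin blank goal).initial 0 ↔
    (toCode f cells origin blank goal).Holds xs (stateName (.inl goal : ControlState Q)) 0 := by
  have hu0 : stateName (.inr (.inr 0) : ControlState Q) ∉
      (toCode f cells origin blank goal).universal := by simp [mem_universal]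
  have hu1 : stateName (.inr (.inr 1) : ControlState Q) ∉
      (toCode f cells origin blank goal).universal := by simp [mem_universal]
  have hi : (toCode f cells origin blank goal).initial =
    stateName (.inr (.inr 0) : ControlState Q) := rfl
  rw [hi]
  simp [UnaryA1CACode.Holds, mem_transitions_marker, markerTransitions, hu0, hu1]

/-- By induction on the letters left: the three subclaims determine the guessed predecessors.
Closure of `cells` under `f` ensures that the correct guess is always available. -/
theorem holds_iff_diagram (ho : origin ∈ cells) (hb : blank ∈ cells)
    (hf : ∀ a ∈ cells, ∀ b ∈ cells, ∀ c ∈ cells, f a b c ∈ cells) (n : ℕ) :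
    ∀ (q : Q) (c : ℤ), (toCode f cells origin blank goal).Holds
      (((List.replicate n ()).map some ++ [none]).flatMap fun x => [x, x])
      (stateName (.inl q : ControlState Q)) c ↔ diagram f (singleCell origin blank) n c = q := by
  have hd : ∀ t c, diagram f (singleCell origin blank) t c ∈ cells := by
    intro t
    induction t with
    | zero => intro c; unfold diagram singleCell; split_ifs <;> assumption
    | succ t ih => exact fun c => hf _ (ih _) _ (ih _) _ (ih _)
  induction n with
  | zero => exact holds_last_marker
  | succ n ih =>
    intro q c
    refine (holds_letter
      (((List.replicate n ()).map some ++ [none]).flatMap fun x => [x, x]) q c).trans ?_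
    simp only [ih]
    constructor
    · rintro ⟨a, -, b, -, d, -, rfl, rfl, rfl, rfl⟩
      rfl
    · rintro rfl
      exact ⟨_, hd _ _, _, hd _ _, _, hd _ _, rfl, rfl, rfl, rfl⟩

theorem language_toCode_eq_zero_iff (ho : origin ∈ cells) (hb : blank ∈ cells)
    (hf : ∀ a ∈ cells, ∀ b ∈ cells, ∀ c ∈ cells, f a b c ∈ cells) :
    (toCode f cells origin blank goal).toA1CA.language = 0 ↔
      ∀ n, diagram f (singleCell origin blank) n 0 ≠ goal := by
  have hw : ∀ w : List Unit, w ∈ (toCode f cells origin blank goal).toA1CA.language ↔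
      diagram f (singleCell origin blank) w.length 0 = goal := by
    intro w
    obtain ⟨n, rfl⟩ : ∃ n, w = List.replicate n () :=
      ⟨w.length, List.eq_replicate_iff.2 ⟨rfl, fun _ _ => rfl⟩⟩
    rw [List.length_replicate, ← holds_iff_diagram (goal := goal) ho hb hf, ← holds_first_marker]
    exact UnaryA1CACode.value_iff_holds _ _ _ _
  constructor
  · intro h n hn
    have := (hw (List.replicate n ())).2 (by simpa using hn)
    rw [h] at this
    exact this
  · intro h
    ext w
    exact ⟨fun hm => (h _ ((hw w).1 hm)).elim, fun hm => hm.elim⟩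

end

/-- Only the list of cell states and the origin state depend on the parameter; the rule is fixed. -/
theorem primrec_toCode {α Q : Type*} [Primcodable α] [Primcodable Q] {f : Q → Q → Q → Q}
    (hf : Primrec fun p : Q × Q × Q => f p.1 p.2.1 p.2.2) {cells : α → List Q}
    (hc : Primrec cells) {origin : α → Q} (ho : Primrec origin) (blank goal : Q) :
    Primrec fun x => toCode f (cells x) (origin x) blank goal := by
  have hn : Primrec fun p : Q × Q × Q => stateName (.inr (.inl p) : ControlState Q) :=
    primrec_stateName.comp (Primrec.sumInr.comp (Primrec.sumInl.comp Primrec.id))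
  have hs : Primrec fun q : Q => stateName (.inl q : ControlState Q) :=
    primrec_stateName.comp (Primrec.sumInl.comp Primrec.id)
  have hu : Primrec fun x => (toCode f (cells x) (origin x) blank goal).universal :=
    Primrec.list_flatMap hc <| Primrec.to₂ <| Primrec.list_flatMap (hc.comp Primrec.fst) <|
      Primrec.to₂ <| Primrec.list_map (hc.comp (Primrec.fst.comp Primrec.fst)) <| Primrec.to₂ <|
        hn.comp (((Primrec.snd.comp Primrec.fst).comp Primrec.fst).pair
          ((Primrec.snd.comp Primrec.fst).pair Primrec.snd))
  have hm : Primrec fun x => markerTransitions (origin x) blank goal := by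
    have h : Primrec fun x => (((stateName (.inl (origin x) : ControlState Q), none, true),
        (stateName (.inr (.inr 2) : ControlState Q), 0)) :
          (ℕ × Option Unit × Bool) × (ℕ × SignType)) :=
      ((hs.comp ho).pair (Primrec.const _)).pair (Primrec.const _)
    exact Primrec.list_cons.comp (Primrec.const _) <| Primrec.list_cons.comp (Primrec.const _) <|
      Primrec.list_cons.comp h (Primrec.const _)
  have ht : ∀ z, Primrec fun p : Q × Q × Q => tripleTransitions f p.1 p.2.1 p.2.2 z := by
    intro z
    have h : ∀ {g : Q × Q × Q → Q} (_ : Primrec g) (k : SignType), Primrec fun p =>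
        (((stateName (.inr (.inl p) : ControlState Q), some (), z),
          (stateName (.inl (g p) : ControlState Q), k)) :
          (ℕ × Option Unit × Bool) × (ℕ × SignType)) := fun hg k =>
      (hn.pair (Primrec.const _)).pair ((hs.comp hg).pair (Primrec.const _))
    have h' : Primrec fun p : Q × Q × Q =>
        (((stateName (.inl (f p.1 p.2.1 p.2.2) : ControlState Q), some (), z),
          (stateName (.inr (.inl p) : ControlState Q), 0)) :
          (ℕ × Option Unit × Bool) × (ℕ × SignType)) :=
      ((hs.comp hf).pair (Primrec.const _)).pair (hn.pair (Primrec.const _))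
    exact Primrec.list_cons.comp h' <| Primrec.list_cons.comp (h Primrec.fst _) <|
      Primrec.list_cons.comp (h (Primrec.fst.comp Primrec.snd) _) <|
      Primrec.list_cons.comp (h (Primrec.snd.comp Primrec.snd) _) (Primrec.const _)
  have htr : Primrec fun x => (toCode f (cells x) (origin x) blank goal).transitions :=
    Primrec.list_append.comp hm <|
    Primrec.list_flatMap hc <| Primrec.to₂ <| Primrec.list_flatMap (hc.comp Primrec.fst) <|
      Primrec.to₂ <| Primrec.list_flatMap (hc.comp (Primrec.fst.comp Primrec.fst)) <| Primrec.to₂ <|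
        (Primrec.list_append.comp (ht true) (ht false)).comp
          (((Primrec.snd.comp Primrec.fst).comp Primrec.fst).pair
          ((Primrec.snd.comp Primrec.fst).pair Primrec.snd))
  exact ((Primrec.of_equiv_symm (e := UnaryA1CACode.equivTuple)).comp
    ((Primrec.const []).pair (hu.pair (htr.pair (Primrec.const
      (stateName (.inr (.inr 0) : ControlState Q),
        stateName (.inr (.inr 2) : ControlState Q))))))).of_eq fun _ => rfl

/-! ### Simulating a Turing machine by a cellular automaton -/

/-- A cell of a cellular automaton that simulates a Turing machine: a tape symbol together with the
state of the head if it is there. The value `none` signals that the machine has halted. -/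
abbrev TapeCell (Γ Λ : Type*) := Option (Γ × Option Λ)

/-- The cells that represent a configuration of a Turing machine with the head in cell `p`. -/
def tapeCells {Γ Λ : Type*} [Inhabited Γ] (C : TM0.Cfg Γ Λ) (p c : ℤ) :
    TapeCell Γ Λ :=
  some (C.Tape.nth (c - p), if c = p then some C.q else none)

theorem tapeCells_self {Γ Λ : Type*} [Inhabited Γ] (C : TM0.Cfg Γ Λ) (p : ℤ) :
    tapeCells C p p = some (C.Tape.nth 0, some C.q) := by
  simp [tapeCells]

theorem tapeCells_of_ne {Γ Λ : Type*} [Inhabited Γ] (C : TM0.Cfg Γ Λ) {p c : ℤ} (h : c ≠ p) :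
    tapeCells C p c = some (C.Tape.nth (c - p), none) := by
  simp [tapeCells, h]

section

variable {Γ Λ : Type*} [Inhabited Λ] (M : TM0.Machine Γ Λ)

/-- The state in which the head leaves a cell in the given direction, if it does. -/
def departing (d : Dir) : Γ × Option Λ → Option Λ
  | (_, none) => none
  | (a, some q) =>
    match M q a with
    | some (q', .move d') => if d' = d then some q' else none
    | _ => none

/-- The local rule that simulates a Turing machine. -/
def tapeRule : TapeCell Γ Λ → TapeCell Γ Λ → TapeCell Γ Λ → TapeCell Γ Λ
  | some _, some (a, some q), some _ =>
    match M q a with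
    | none => none
    | some (_, .move _) => some (a, none)
    | some (q', .write b) => some (b, some q')
  | some l, some (a, none), some r =>
    some (a, (departing M Dir.right l).or (departing M Dir.left r))
  | _, _, _ => none

theorem tapeRule_none_left (x r : TapeCell Γ Λ) : tapeRule M none x r = none := by
  rcases x with - | ⟨a, - | q⟩ <;> cases r <;> rfl

theorem tapeRule_none_middle (l r : TapeCell Γ Λ) : tapeRule M l none r = none := by
  cases l <;> cases r <;> rfl

theorem tapeRule_none_right (l x : TapeCell Γ Λ) : tapeRule M l x none = none := by
  rcases x with - | ⟨a, - | q⟩ <;> cases l <;> rfl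

/-- The state `none` is absorbing from every side, so it spreads by one cell per step in both
directions. -/
theorem diagram_tapeRule_halted {g : ℤ → TapeCell Γ Λ} {t : ℕ} {p : ℤ}
    (h : diagram (tapeRule M) g t p = none) (k : ℕ) :
    ∀ c, |c - p| ≤ k → diagram (tapeRule M) g (t + k) c = none := by
  induction k with
  | zero =>
    intro c hc
    obtain rfl : c = p := by simpa [sub_eq_zero] using hc
    exact h
  | succ k ih =>
    intro c hc
    rw [abs_le] at hc
    push_cast at hc
    rw [← add_assoc, diagram]
    rcases lt_trichotomy c p with hlt | rfl | hlt
    · rw [ih (c + 1) (abs_le.2 ⟨by omega, by omega⟩), tapeRule_none_right]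
    · rw [ih c (by simp), tapeRule_none_middle]
    · rw [ih (c - 1) (abs_le.2 ⟨by omega, by omega⟩), tapeRule_none_left]

/-! ### Loading the input and running the machine -/

/-- The local rule that first writes an input `a b ⋯ b` on a blank tape and then simulates a Turing
machine on it. The cell `Sum.inr j` writes `b` and causes its left neighbour to write another `j`
letters `b` and the initial letter `a`. -/
def loadRule (a b : Γ) : TapeCell Γ Λ ⊕ ℕ → TapeCell Γ Λ ⊕ ℕ → TapeCell Γ Λ ⊕ ℕ →
    TapeCell Γ Λ ⊕ ℕ
  | _, _, .inr 0 => .inl (some (a, some default))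
  | _, _, .inr (j + 1) => .inr j
  | _, .inr _, .inl _ => .inl (some (b, none))
  | .inr _, .inl x, .inl _ => .inl x
  | .inl l, .inl x, .inl r => .inl (tapeRule M l x r)

theorem primrec_loadRule [Primcodable Γ] [Primcodable Λ] [Finite Γ] [Finite Λ] (a b : Γ) :
    Primrec fun p : (TapeCell Γ Λ ⊕ ℕ) × (TapeCell Γ Λ ⊕ ℕ) × (TapeCell Γ Λ ⊕ ℕ) =>
      loadRule M a b p.1 p.2.1 p.2.2 := by
  have h3 : Primrec fun p : TapeCell Γ Λ × TapeCell Γ Λ × TapeCell Γ Λ =>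
      tapeRule M p.1 p.2.1 p.2.2 := Primrec.dom_finite _
  have hr : Primrec fun j : ℕ => (Nat.casesOn j (.inl (some (a, some default))) Sum.inr :
      TapeCell Γ Λ ⊕ ℕ) :=
    Primrec.nat_casesOn Primrec.id (Primrec.const _) (Primrec.sumInr.comp Primrec.snd).to₂
  refine Primrec.of_eq (Primrec.sumCasesOn (Primrec.snd.comp Primrec.snd)
    (Primrec.to₂ <| Primrec.sumCasesOn ((Primrec.fst.comp Primrec.snd).comp Primrec.fst)
      (Primrec.to₂ <| Primrec.sumCasesOn (Primrec.fst.comp (Primrec.fst.comp Primrec.fst))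
        (Primrec.to₂ <| Primrec.sumInl.comp <| h3.comp <| Primrec.snd.pair <|
          (Primrec.snd.comp Primrec.fst).pair (Primrec.snd.comp (Primrec.fst.comp Primrec.fst)))
        (Primrec.to₂ <| Primrec.sumInl.comp (Primrec.snd.comp Primrec.fst)))
      (Primrec.to₂ <| Primrec.const (.inl (some (b, none)))))
    (Primrec.to₂ <| hr.comp Primrec.snd)) ?_
  rintro ⟨l | l, x | x, r | r | r⟩ <;> rfl

variable [Inhabited Γ]

/-- Tape symbols stay in their cells: when the head moves, the shift of `p'` cancels the recentring
of the tape. -/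
theorem tapeRule_tapeCells {C C' : TM0.Cfg Γ Λ} (h : TM0.step M C = some C') (p : ℤ) :
    ∃ p', ∀ c, tapeRule M (tapeCells C p (c - 1)) (tapeCells C p c) (tapeCells C p (c + 1)) =
      tapeCells C' p' c := by
  obtain ⟨q, T⟩ := C
  obtain ⟨⟨q', s⟩, hM, rfl⟩ := Option.map_eq_some_iff.1 h
  have hM' : M q (T.nth 0) = some (q', s) := hM
  -- Only the head cell and its two neighbours can see the head.
  have cases_c : ∀ c, c = p ∨ c = p + 1 ∨ c = p - 1 ∨ (c ≠ p ∧ c - 1 ≠ p ∧ c + 1 ≠ p) := by omega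
  have n1 : p + 1 ≠ p := by omega
  have n2 : p - 1 ≠ p := by omega
  have n3 : p + 1 + 1 ≠ p := by omega
  have n4 : p - 1 - 1 ≠ p := by omega
  have e1 : p + 1 - 1 = p := by omega
  have e2 : p - 1 + 1 = p := by omega
  cases s with
  | write b =>
    refine ⟨p, fun c => ?_⟩
    rcases cases_c c with rfl | rfl | rfl | ⟨h1, h2, h3⟩
    · simp only [tapeCells_self, tapeCells_of_ne _ n1, tapeCells_of_ne _ n2, tapeRule, hM',
        Tape.write_nth, if_true]
    · have hz : p + 1 - p ≠ 0 := by omega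
      simp only [e1, tapeCells_self, tapeCells_of_ne _ n1, tapeCells_of_ne _ n3, tapeRule,
        departing, hM', Tape.write_nth, Option.or_none, if_neg hz]
    · have hz : p - 1 - p ≠ 0 := by omega
      simp only [e2, tapeCells_self, tapeCells_of_ne _ n2, tapeCells_of_ne _ n4, tapeRule,
        departing, hM', Tape.write_nth, Option.or_none, if_neg hz]
    · simp only [tapeCells_of_ne _ h1, tapeCells_of_ne _ h2, tapeCells_of_ne _ h3, tapeRule,
        departing, Tape.write_nth, Option.or_none, if_neg (sub_ne_zero.2 h1)]
  | move d =>
    cases d with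
    | left =>
      refine ⟨p - 1, fun c => ?_⟩
      have hs : c - (p - 1) - 1 = c - p := by omega
      rcases cases_c c with rfl | rfl | rfl | ⟨h1, h2, h3⟩
      · simp only [tapeCells_self, tapeCells_of_ne _ n1, tapeCells_of_ne _ n2,
          tapeCells_of_ne _ n2.symm, tapeRule, hM', Tape.move_left_nth, hs, sub_self]
      · have n5 : p + 1 ≠ p - 1 := by omega
        simp only [e1, tapeCells_self, tapeCells_of_ne _ n1, tapeCells_of_ne _ n3,
          tapeCells_of_ne _ n5, tapeRule, departing, hM', Tape.move_left_nth, hs, Option.or_none,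
          reduceCtorEq, if_false]
      · have hz : (0 : ℤ) - 1 = p - 1 - p := by omega
        simp only [e2, tapeCells_self, tapeCells_of_ne _ n2, tapeCells_of_ne _ n4, tapeRule,
          departing, hM', Tape.move_left_nth, Option.none_or, if_true, hz]
      · have n5 : c ≠ p - 1 := by omega
        simp only [tapeCells_of_ne _ h1, tapeCells_of_ne _ h2, tapeCells_of_ne _ h3,
          tapeCells_of_ne _ n5, tapeRule, departing, Tape.move_left_nth, hs, Option.or_none]
    | right =>
      refine ⟨p + 1, fun c => ?_⟩
      have hs : c - (p + 1) + 1 = c - p := by omega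
      rcases cases_c c with rfl | rfl | rfl | ⟨h1, h2, h3⟩
      · simp only [tapeCells_self, tapeCells_of_ne _ n1, tapeCells_of_ne _ n2,
          tapeCells_of_ne _ n1.symm, tapeRule, hM', Tape.move_right_nth, hs, sub_self]
      · have hz : (0 : ℤ) + 1 = p + 1 - p := by omega
        simp only [e1, tapeCells_self, tapeCells_of_ne _ n1, tapeCells_of_ne _ n3, tapeRule,
          departing, hM', Tape.move_right_nth, Option.or_none, if_true, hz]
      · have n5 : p - 1 ≠ p + 1 := by omega
        simp only [e2, tapeCells_self, tapeCells_of_ne _ n2, tapeCells_of_ne _ n4,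
          tapeCells_of_ne _ n5, tapeRule, departing, hM', Tape.move_right_nth, hs, Option.or_none,
          reduceCtorEq, if_false]
      · have n5 : c ≠ p + 1 := by omega
        simp only [tapeCells_of_ne _ h1, tapeCells_of_ne _ h2, tapeCells_of_ne _ h3,
          tapeCells_of_ne _ n5, tapeRule, departing, Tape.move_right_nth, hs, Option.or_none]

theorem tapeRule_of_halt {C : TM0.Cfg Γ Λ} (h : TM0.step M C = none) (p : ℤ) :
    tapeRule M (tapeCells C p (p - 1)) (tapeCells C p p) (tapeCells C p (p + 1)) = none := by
  have hM : M C.q C.Tape.head = none := Option.map_eq_none_iff.1 h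
  simp [tapeCells, tapeRule, hM]

/-- A cell is eventually reached by the halting signal if and only if the machine halts. -/
theorem exists_diagram_tapeRule_eq_none_iff (C : TM0.Cfg Γ Λ) (p c : ℤ) :
    (∃ t, diagram (tapeRule M) (tapeCells C p) t c = none) ↔
      (StateTransition.eval (TM0.step M) C).Dom := by
  constructor
  · rw [← not_imp_not]
    intro hd
    -- Without halting, every row of the diagram encodes a reachable configuration and so contains
    -- no `none`.
    suffices h : ∀ t, ∃ C' p', StateTransition.Reaches (TM0.step M) C C' ∧
        ∀ c, diagram (tapeRule M) (tapeCells C p) t c = tapeCells C' p' c by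
      rintro ⟨t, ht⟩
      obtain ⟨C', p', -, h⟩ := h t
      simp [h, tapeCells] at ht
    intro t
    induction t with
    | zero => exact ⟨C, p, .refl, fun _ => rfl⟩
    | succ t ih =>
      obtain ⟨C', p', hr, h⟩ := ih
      cases hs : TM0.step M C' with
      | none => exact absurd (Part.dom_iff_mem.2 ⟨_, StateTransition.mem_eval.2 ⟨hr, hs⟩⟩) hd
      | some C'' =>
        obtain ⟨p'', h''⟩ := tapeRule_tapeCells M hs p'
        exact ⟨C'', p'', hr.tail hs, fun c => by rw [diagram, h, h, h, h'']⟩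
  · intro hd
    obtain ⟨C', hC'⟩ := Part.dom_iff_mem.1 hd
    obtain ⟨hr, hs⟩ := StateTransition.mem_eval.1 hC'
    have key : ∃ t p', ∀ c, diagram (tapeRule M) (tapeCells C p) t c = tapeCells C' p' c := by
      clear hC' hs
      induction hr with
      | refl => exact ⟨0, p, fun _ => rfl⟩
      | tail _ hs ih =>
        obtain ⟨t, p', h⟩ := ih
        obtain ⟨p'', h''⟩ := tapeRule_tapeCells M hs p'
        exact ⟨t + 1, p'', fun c => by rw [diagram, h, h, h, h'']⟩
    obtain ⟨t, p', h⟩ := key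
    have hp : diagram (tapeRule M) (tapeCells C p) (t + 1) p' = none := by
      rw [diagram, h, h, h, tapeRule_of_halt M hs]
    -- The signal starts in cell `p'` and needs `|c - p'|` further steps to reach `c`.
    exact ⟨_, diagram_tapeRule_halted M hp (c - p').natAbs c (by simp)⟩

/-- The loader moves left at speed one, leaving letters `b` behind it. No head exists yet, so
`tapeRule` changes nothing. -/
theorem diagram_loadRule_of_le (a b : Γ) (n : ℕ) {t : ℕ} (ht : t ≤ n) (c : ℤ) :
    diagram (loadRule M a b) (singleCell (.inr n) (.inl (some (default, none)))) t c =
      if c = -t then .inr (n - t) else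
        .inl (some (if -t < c ∧ c ≤ 0 then b else default, none)) := by
  induction t generalizing c with
  | zero =>
    rw [diagram, singleCell]
    by_cases hc : c = 0
    · simp [hc]
    · have : ¬ (0 < c ∧ c ≤ 0) := by omega
      simp [hc, this]
  | succ t ih =>
    have ih := ih (by omega)
    obtain ⟨j, hj⟩ : ∃ j, n - t = j + 1 := ⟨n - t - 1, by omega⟩
    have hj' : n - (t + 1) = j := by omega
    rw [diagram, ih, ih, ih, hj, hj']
    push_cast
    rcases eq_or_ne (c + 1) (-t) with h1 | h1
    · have h2 : c = -(t + 1) := by omega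
      rw [if_pos h1, if_pos h2]
      simp only [loadRule]
    · have h2 : c ≠ -(t + 1) := by omega
      rw [if_neg h1, if_neg h2]
      rcases eq_or_ne c (-t) with h3 | h3
      · have h4 : -((t : ℤ) + 1) < c ∧ c ≤ 0 := by omega
        rw [if_pos h3, if_pos h4]
        simp only [loadRule]
      · have h4 : (-((t : ℤ) + 1) < c ∧ c ≤ 0) ↔ (-(t : ℤ) < c ∧ c ≤ 0) := by omega
        rw [if_neg h3]
        simp only [h4]
        by_cases h5 : c - 1 = -t
        · rw [if_pos h5]
          simp only [loadRule]
        · rw [if_neg h5]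
          simp only [loadRule, tapeRule, departing, Option.or_none]

theorem nth_mk₁_cons_replicate (a b : Γ) (n : ℕ) (i : ℤ) :
    (Tape.mk₁ (a :: List.replicate n b)).nth i =
      if i = 0 then a else if 0 < i ∧ i ≤ n then b else default := by
  cases i with
  | ofNat i =>
    rw [Int.ofNat_eq_natCast, Tape.mk₁, Tape.mk₂, Tape.mk'_nth_nat, ListBlank.nth_mk]
    cases i with
    | zero => simp
    | succ i =>
      rw [List.getI_cons_succ, List.getI_eq_getElem?_getD, List.getElem?_replicate]
      have h : ((i + 1 : ℕ) : ℤ) ≠ 0 := by omega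
      rw [if_neg h]
      by_cases hi : i < n
      · rw [if_pos hi, if_pos (by omega)]; rfl
      · rw [if_neg hi, if_neg (by omega)]; rfl
  | negSucc i =>
    rw [if_neg (by omega), if_neg (by omega)]
    change (ListBlank.mk ([] : List Γ)).nth i = default
    rw [ListBlank.nth_mk, List.getI_nil]

/-- At time `n` the loader is `inr 0` in cell `-n`. One more step turns it into the last of the `n +
1` letters `b` and puts `a` with the head to its left. -/
theorem diagram_loadRule_loaded (a b : Γ) (n : ℕ) (c : ℤ) :
    diagram (loadRule M a b) (singleCell (.inr n) (.inl (some (default, none)))) (n + 1) c =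
      .inl (tapeCells (TM0.init (a :: List.replicate (n + 1) b)) (-(n + 1)) c) := by
  have ih := diagram_loadRule_of_le M a b n le_rfl
  have hs : c - -((n : ℤ) + 1) = c + 1 + n := by omega
  rw [diagram, ih, ih, ih, Nat.sub_self, tapeCells, TM0.init, nth_mk₁_cons_replicate, hs]
  push_cast
  rcases eq_or_ne (c + 1) (-n) with h1 | h1
  · have h2 : c = -(n + 1) := by omega
    have h3 : c + 1 + n = 0 := by omega
    rw [if_pos h1, if_pos h2, if_pos h3]
    simp only [loadRule]
  · have h2 : c ≠ -(n + 1) := by omega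
    have h3 : c + 1 + n ≠ 0 := by omega
    rw [if_neg h1, if_neg h2, if_neg h3]
    rcases eq_or_ne c (-n) with h4 | h4
    · have h5 : 0 < c + 1 + n ∧ c + 1 + n ≤ n + 1 := by omega
      rw [if_pos h4, if_pos h5]
      simp only [loadRule]
    · have h5 : (0 < c + 1 + n ∧ c + 1 + n ≤ n + 1) ↔ (-(n : ℤ) < c ∧ c ≤ 0) := by omega
      rw [if_neg h4]
      simp only [h5]
      by_cases h6 : c - 1 = -n
      · rw [if_pos h6]
        simp only [loadRule]
      · rw [if_neg h6]
        simp only [loadRule, tapeRule, departing, Option.or_none]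

/-- Once no loader cell is left, `loadRule` acts as `tapeRule`. -/
theorem diagram_loadRule_add (a b : Γ) (n k : ℕ) (c : ℤ) :
    diagram (loadRule M a b) (singleCell (.inr n) (.inl (some (default, none)))) (n + 1 + k) c =
      .inl (diagram (tapeRule M)
        (tapeCells (TM0.init (a :: List.replicate (n + 1) b)) (-(n + 1))) k c) := by
  induction k generalizing c with
  | zero => exact diagram_loadRule_loaded M a b n c
  | succ k ih => rw [← add_assoc, diagram, ih, ih, ih, diagram, loadRule]

theorem exists_diagram_loadRule_eq_iff (a b : Γ) (n : ℕ) :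
    (∃ t, diagram (loadRule M a b) (singleCell (.inr n) (.inl (some (default, none)))) t 0 =
      .inl none) ↔ (TM0.eval M (a :: List.replicate (n + 1) b)).Dom := by
  refine Iff.trans ?_ (exists_diagram_tapeRule_eq_none_iff M
    (TM0.init (a :: List.replicate (n + 1) b)) (-(n + 1)) 0)
  constructor
  · rintro ⟨t, ht⟩
    -- The goal state cannot occur while the input is being written.
    rcases le_or_gt t n with h | h
    · rw [diagram_loadRule_of_le M a b n h] at ht
      split_ifs at ht <;> simp at ht
    · obtain ⟨k, rfl⟩ := Nat.exists_eq_add_of_lt h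
      rw [add_right_comm, diagram_loadRule_add] at ht
      exact ⟨k, Sum.inl_injective ht⟩
  · rintro ⟨k, hk⟩
    exact ⟨n + 1 + k, by rw [diagram_loadRule_add, hk]⟩

/-- The halting problem of a Turing machine on inputs `a b ⋯ b` is reduced to the emptiness problem
for unary alternating one-counter automata. -/
theorem exists_primrec_language_eq_zero_iff [Finite Γ] [Finite Λ] (a b : Γ) :
    ∃ F : ℕ → UnaryA1CACode, Primrec F ∧ ∀ n,
      (F n).toA1CA.language = 0 ↔ ¬ (TM0.eval M (a :: List.replicate (n + 1) b)).Dom := by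
  let : Primcodable Γ := Primcodable.ofEquiv _ (Finite.equivFin Γ)
  let : Primcodable Λ := Primcodable.ofEquiv _ (Finite.equivFin Λ)
  obtain ⟨tapeList, -, htape⟩ := Finite.exists_univ_list (TapeCell Γ Λ)
  -- For each `n` finitely many states suffice, since the rule only ever decreases the loader's
  -- number.
  let cells : ℕ → List (TapeCell Γ Λ ⊕ ℕ) := fun n =>
    tapeList.map Sum.inl ++ (List.range (n + 1)).map Sum.inr
  have hcells : Primrec cells := Primrec.list_append.comp (Primrec.const _)
    (Primrec.list_map (Primrec.list_range.comp Primrec.succ) (Primrec.sumInr.comp Primrec.snd).to₂)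
  have hl : ∀ n x, Sum.inl x ∈ cells n := fun n x => by simp [cells, htape]
  have hr : ∀ n j, Sum.inr j ∈ cells n ↔ j ≤ n := fun n x => by simp [cells]
  refine ⟨fun n => toCode (loadRule M a b) (cells n) (.inr n) (.inl (some (default, none)))
    (.inl none), primrec_toCode (primrec_loadRule M a b) hcells Primrec.sumInr _ _, fun n => ?_⟩
  rw [language_toCode_eq_zero_iff ((hr n n).2 le_rfl) (hl n _) ?_,
    ← exists_diagram_loadRule_eq_iff, not_exists]
  rintro (l | l) hl' (x | x) hx (r | r | r) hr' <;>
    first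
    | exact hl n _
    | exact (hr n _).2 (Nat.le_of_succ_le ((hr n _).1 hr'))

end

end CellularAutomaton

/-- No algorithm decides, given a description of an alternating one-counter automaton over a unary
alphabet, whether its language is empty (`0` is the empty language). -/
theorem theorem1 :
    ¬ ComputablePred (fun d : UnaryA1CACode => d.toA1CA.language = 0) := by
  intro h
  obtain ⟨Γ, Λ, _, _, _, _, M, a, b, hM⟩ := exists_turingMachine_undecidable
  obtain ⟨F, hF, hFM⟩ := CellularAutomaton.exists_primrec_language_eq_zero_iff M a b
  refine hM (ComputablePred.of_eq (ComputablePred.not (p := fun n => (F n).toA1CA.language = 0) ?_)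
    fun n => by rw [hFM, not_not])
  obtain ⟨p, hp, hpe⟩ := ComputablePred.computable_iff.1 h
  exact ComputablePred.computable_iff.2 ⟨fun n => p (F n), hp.comp hF.to_comp,
    funext fun n => congrFun hpe (F n)⟩
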